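/- Let $\mathbf{k}$ be a commutative ring, $d\ge 0$, and let $\pi$ be a non-trivial element of the symmetric group $\mathfrak{S}_d$. For $\sigma\in\mathfrak S_d$ let $\operatorname{inv}(\sigma)=\#\{a<b : \sigma(b)<\sigma(a)\}$. Let $\le$ be the Bruhat order on $\mathfrak S_d$ ($\sigma\le\tau$ if and only if some reduced expression of $\tau$ in the simple transpositions contains a reduced expression of $\sigma$ as a subword), write $\sigma\triangleleft\tau$ if $\sigma<\tau$ and $\operatorname{inv}(\tau)=\operatorname{inv}(\sigma)+1$, and let $[e,\pi]=\{\sigma : e\le\sigma\le\pi\}$, where $e$ is the identity. A balanced signature on the Hasse diagram of $[e,\pi]$ is an assignment of a sign $\varepsilon(\sigma\triangleleft\tau)\in\{\pm1\}$ to every edge $\sigma\triangleleft\tau$ with $\sigma,\tau\in[e,\pi]$ such that $$\varepsilon(\pi_b\triangleleft\pi_a)\,\varepsilon(\pi_d\triangleleft\pi_b)+\varepsilon(\pi_c\triangleleft\pi_a)\,\varepsilon(\pi_d\triangleleft\pi_c)=0$$ for every square $\pi_d\triangleleft\pi_b\triangleleft\pi_a$, $\pi_d\triangleleft\pi_c\triangleleft\pi_a$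 with $\pi_b\ne\pi_c$ in $[e,\pi]$. For a balanced signature $\varepsilon$, let $C[e,\pi]$ be the free graded $\mathbf{k}$-module with basis $[e,\pi]$, where $\sigma$ has degree $-\operatorname{inv}(\sigma)$, with the map $\partial_\varepsilon(\sigma)=\sum_{\tau\triangleleft\sigma}\varepsilon(\tau\triangleleft\sigma)\,\tau$ of degree $1$. Then $\partial_\varepsilon^2=0$ for every balanced signature $\varepsilon$, so that $(C[e,\pi],\partial_\varepsilon)$ is a cochain complex of $\mathbf{k}$-modules, and: 1. There exists a balanced signature $\varepsilon$ on the Hasse diagram of $[e,\pi]$ such that $(C[e,\pi],\partial_\varepsilon)$ is acyclic. 2. For any two balanced signatures $\varepsilon,\varepsilon'$ on the Hasse diagram of $[e,\pi]$, the cochain complexes $(C[e,\pi],\partial_\varepsilon)$ and $(C[e,\pi],\partial_{\varepsilon'})$ are isomorphic. In particular, $(C[e,\pi],\partial_\varepsilon)$ is acyclic for every balanced signature $\varepsilon$ on the Hasse diagram of $[e,\pi]$. -/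

import Mathlib

open CategoryTheory

universe u

noncomputable section

namespace Bruhat

/-- The alphabet of the simple transpositions of the symmetric group on `d` letters: the letter
`a` (counted from `0`) stands for the transposition exchanging `a` and `a + 1`. -/
abbrev Letter (d : ℕ) : Type := {a : ℕ // a + 1 < d}

/-- The simple transposition exchanging `a` and `a + 1`. -/
def simple {d : ℕ} (a : Letter d) : Equiv.Perm (Fin d) :=
  Equiv.swap ⟨a.1, Nat.lt_of_succ_lt a.2⟩ ⟨a.1 + 1, a.2⟩

/-- The permutation represented by a word in the simple transpositions. -/
def wordProd {d : ℕ} (w : List (Letter d)) : Equiv.Perm (Fin d) :=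
  (w.map simple).prod

/-- `w` is a reduced expression for `π`: it represents `π`, and no shorter word does. -/
def IsReducedExpr {d : ℕ} (w : List (Letter d)) (π : Equiv.Perm (Fin d)) : Prop :=
  wordProd w = π ∧ ∀ v : List (Letter d), wordProd v = π → w.length ≤ v.length

/-- The Bruhat order: `σ ≤ π` if some reduced expression of `π` contains a reduced expression
of `σ` as a (not necessarily contiguous) subword. -/
def LE {d : ℕ} (σ π : Equiv.Perm (Fin d)) : Prop :=
  ∃ w v : List (Letter d), IsReducedExpr w π ∧ IsReducedExpr v σ ∧ v.Sublist w

/-- The number of inversions of a permutation. -/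
def inv {d : ℕ} (π : Equiv.Perm (Fin d)) : ℕ :=
  (Finset.univ.filter fun p : Fin d × Fin d => p.1 < p.2 ∧ π p.2 < π p.1).card

/-- The relation `σ ◁ π`: `σ < π` in the Bruhat order and `inv π = inv σ + 1`. -/
def Covered {d : ℕ} (σ π : Equiv.Perm (Fin d)) : Prop :=
  (LE σ π ∧ σ ≠ π) ∧ inv π = inv σ + 1

/-- The Bruhat interval `[σ, π]`. -/
def interval {d : ℕ} (σ π : Equiv.Perm (Fin d)) : Set (Equiv.Perm (Fin d)) :=
  {τ | LE σ τ ∧ LE τ π}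

/-- A balanced signature on the Hasse diagram of the Bruhat interval `[e, π]`: a sign for each
edge `x ◁ y`, such that the two products of signs along the two sides of any square
`z ◁ b ◁ a`, `z ◁ c ◁ a` with `b ≠ c` add up to zero. -/
structure BalancedSignature {d : ℕ} (π : Equiv.Perm (Fin d)) where
  /-- The sign of the edge `x ◁ y`. -/
  sign : ∀ x y : interval 1 π, Covered x.1 y.1 → ℤˣ
  balanced : ∀ (a b c z : interval 1 π), b ≠ c →
    ∀ (hba : Covered b.1 a.1) (hzb : Covered z.1 b.1)
      (hca : Covered c.1 a.1) (hzc : Covered z.1 c.1),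
      (sign b a hba : ℤ) * (sign z b hzb : ℤ) + (sign c a hca : ℤ) * (sign z c hzc : ℤ) = 0

/-- The elements of `[e, π]` of cohomological degree `n`, where `x` has degree `- inv x`. -/
abbrev Degree {d : ℕ} (π : Equiv.Perm (Fin d)) (n : ℤ) : Type :=
  {x : interval 1 π // -(inv x.1 : ℤ) = n}

open Classical in
/-- The degree `n` component of the differential, on the free `k`-module with basis `[e, π]`:
a basis element `x` is sent to the sum of `sign y x • y` over all `y ◁ x` in `[e, π]`; these `y`
have degree `n + 1`. -/
def diff (k : Type u) [CommRing k] {d : ℕ} {π : Equiv.Perm (Fin d)}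
    (ε : BalancedSignature π) (n : ℤ) : (Degree π n →₀ k) →ₗ[k] (Degree π (n + 1) →₀ k) :=
  Finsupp.linearCombination k fun x : Degree π n =>
    ∑ y : Degree π (n + 1),
      if h : Covered y.1.1 x.1.1 then
        Finsupp.single y (((ε.sign y.1 x.1 h : ℤˣ) : ℤ) : k)
      else 0

/-- The assertion that the differential squares to zero. -/
def SquareZero (k : Type u) [CommRing k] {d : ℕ} {π : Equiv.Perm (Fin d)}
    (ε : BalancedSignature π) : Prop :=
  ∀ n : ℤ, diff k ε (n + 1) ∘ₗ diff k ε n = 0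

/-- The cochain complex of `k`-modules `(C[e, π], ∂_ε)`. -/
def complex (k : Type u) [CommRing k] {d : ℕ} {π : Equiv.Perm (Fin d)}
    (ε : BalancedSignature π) (h : SquareZero k ε) : CochainComplex (ModuleCat.{u} k) ℤ :=
  CochainComplex.of (fun n => ModuleCat.of k (Degree π n →₀ k))
    (fun n => ModuleCat.ofHom (diff k ε n))
    (fun n => by rw [← ModuleCat.ofHom_comp, h n]; rfl)

end Bruhat

end

/-! Fix a right descent s of π, which exists because π ≠ e. By the lifting property, x ↦ xs is a
fixed-point-free involution of [e, π], so it pairs each non-descent x with the cover x ◁ xs. Let h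
send x to ε(x ◁ xs)·xs if s is not a descent of x, and to 0 otherwise. A cover from a non-descent to
a descent must be x ◁ xs, and all other terms of ∂h + h∂ cancel along squares; hence ∂h + h∂ = 1 for
every balanced ε, and every complex is acyclic (`diffMatrix_homotopy`).

That ∂² = 0 follows because an interval of length two has exactly two middle elements
(`exists_middle_pair`). Signatures are built by induction on the length of the top y of an edge: for
a descent s of y, the sign of ys ◁ y is free, and the square y, x, ys, xs determines the sign of
every other edge x ◁ y (`exists_balancedUpTo`). The same induction shows that two signatures differ
by a rescaling of the basis (`exists_coboundary`).

The combinatorics rests on strong exchange, which turns covers defined by subwords into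
multiplication by transpositions (`covered_iff`). -/

namespace Bruhat

/-! ### Descents, reduced words and the Bruhat order. -/

section Combinatorics

variable {d : ℕ}

/-- `a` is a right descent of `x`. -/
def Descent (x : Equiv.Perm (Fin d)) (a : Letter d) : Prop :=
  x ⟨a.1 + 1, a.2⟩ < x ⟨a.1, Nat.lt_of_succ_lt a.2⟩

lemma simple_mul_self (a : Letter d) : simple a * simple a = 1 := Equiv.swap_mul_self _ _

@[simp] lemma mul_simple_mul_simple (x : Equiv.Perm (Fin d)) (a : Letter d) :
    x * simple a * simple a = x := by
  rw [mul_assoc, simple_mul_self, mul_one]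

lemma simple_simple (a : Letter d) (i : Fin d) : simple a (simple a i) = i :=
  Equiv.swap_apply_self _ _ _

lemma simple_lt_simple (a : Letter d) {i j : Fin d} (hij : i < j)
    (h : ¬ (i.1 = a.1 ∧ j.1 = a.1 + 1)) : simple a i < simple a j := by
  unfold simple
  simp only [Equiv.swap_apply_def, Fin.ext_iff, Fin.lt_def] at *
  split_ifs <;> (try dsimp only at *) <;> omega

lemma descent_mul_simple (x : Equiv.Perm (Fin d)) (a : Letter d) :
    Descent (x * simple a) a ↔ ¬ Descent x a := by
  unfold Descent simple
  rw [Equiv.Perm.mul_apply, Equiv.Perm.mul_apply, Equiv.swap_apply_left, Equiv.swap_apply_right,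
    not_lt]
  refine ⟨le_of_lt, fun h => lt_of_le_of_ne h fun e => ?_⟩
  have := x.injective e
  simp at this

/-- Exchanging the positions a and a + 1 carries the inversions of x to those of the product, which
has only (a, a + 1) in addition. -/
lemma inv_mul_simple_of_not_descent {x : Equiv.Perm (Fin d)} {a : Letter d}
    (h : ¬ Descent x a) : inv (x * simple a) = inv x + 1 := by
  classical
  have hd := (descent_mul_simple x a).2 h
  set p : Fin d × Fin d := (⟨a.1, Nat.lt_of_succ_lt a.2⟩, ⟨a.1 + 1, a.2⟩) with hp
  have key : (Finset.univ.filter fun q : Fin d × Fin d =>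
      q.1 < q.2 ∧ (x * simple a) q.2 < (x * simple a) q.1) =
      insert p ((Finset.univ.filter fun q : Fin d × Fin d =>
        q.1 < q.2 ∧ x q.2 < x q.1).image fun q => (simple a q.1, simple a q.2)) := by
    ext ⟨i, j⟩
    simp only [Finset.mem_filter, Finset.mem_univ, true_and, Finset.mem_insert, Finset.mem_image,
      Prod.exists, Prod.mk.injEq, hp]
    constructor
    · rintro ⟨hij, hx⟩
      by_cases hc : i.1 = a.1 ∧ j.1 = a.1 + 1
      · left; exact ⟨Fin.ext hc.1, Fin.ext hc.2⟩
      · right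
        exact ⟨simple a i, simple a j, ⟨simple_lt_simple a hij hc, hx⟩,
          simple_simple a i, simple_simple a j⟩
    · rintro (⟨rfl, rfl⟩ | ⟨i', j', ⟨hij, hx⟩, rfl, rfl⟩)
      · exact ⟨by simp [Fin.lt_def], hd⟩
      · refine ⟨simple_lt_simple a hij ?_, by simpa [simple_simple] using hx⟩
        rintro ⟨h1, h2⟩
        apply h
        have e1 : i' = ⟨a.1, Nat.lt_of_succ_lt a.2⟩ := Fin.ext h1
        have e2 : j' = ⟨a.1 + 1, a.2⟩ := Fin.ext h2
        rw [e1, e2] at hx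
        exact hx
  unfold inv
  rw [key, Finset.card_insert_of_notMem, Finset.card_image_of_injective]
  · rintro ⟨i, j⟩ ⟨i', j'⟩ e
    simp only [Prod.mk.injEq, EmbeddingLike.apply_eq_iff_eq] at e
    simp [e]
  · simp only [Finset.mem_image, Finset.mem_filter, Finset.mem_univ, true_and, Prod.exists, hp,
      Prod.mk.injEq, not_exists, not_and]
    rintro i j ⟨hij, -⟩ e1 e2
    have e1' := congrArg (simple a) e1
    have e2' := congrArg (simple a) e2
    rw [simple_simple] at e1' e2'
    simp only [simple, Equiv.swap_apply_left, Equiv.swap_apply_right] at e1' e2'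
    subst e1' e2'
    simp [Fin.lt_def] at hij

lemma inv_mul_simple_of_descent {x : Equiv.Perm (Fin d)} {a : Letter d}
    (h : Descent x a) : inv x = inv (x * simple a) + 1 := by
  have := inv_mul_simple_of_not_descent (x := x * simple a) (a := a)
    (fun h' => (descent_mul_simple x a).1 h' h)
  rwa [mul_simple_mul_simple] at this

lemma exists_descent {x : Equiv.Perm (Fin d)} (hx : x ≠ 1) : ∃ a, Descent x a := by
  by_contra! h
  apply hx
  obtain _ | n := d
  · exact Subsingleton.elim _ _
  have hm : StrictMono x := by
    rw [Fin.strictMono_iff_lt_succ]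
    intro i
    have := h ⟨i.1, by omega⟩
    unfold Descent at this
    refine lt_of_le_of_ne (not_lt.1 this) fun e => ?_
    have := x.injective e
    simp [Fin.ext_iff] at this
  ext i
  have := DFunLike.congr_fun (Subsingleton.elim (hm.orderIsoOfSurjective x x.surjective)
    (OrderIso.refl _)) i
  simpa using congrArg Fin.val this

lemma wordProd_append_singleton (w : List (Letter d)) (a : Letter d) :
    wordProd (w ++ [a]) = wordProd w * simple a := by
  simp [wordProd]

lemma inv_one : inv (1 : Equiv.Perm (Fin d)) = 0 := by
  unfold inv
  rw [Finset.card_eq_zero, Finset.filter_eq_empty_iff]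
  rintro ⟨i, j⟩ - ⟨h1, h2⟩
  exact lt_asymm h1 h2

lemma inv_wordProd_le (w : List (Letter d)) : inv (wordProd w) ≤ w.length := by
  induction w using List.reverseRecOn with
  | nil => simp [wordProd, inv_one]
  | append_singleton w a ih =>
    rw [wordProd_append_singleton, List.length_append, List.length_singleton]
    by_cases h : Descent (wordProd w) a
    · have := inv_mul_simple_of_descent h; omega
    · have := inv_mul_simple_of_not_descent h; omega

lemma exists_word (x : Equiv.Perm (Fin d)) : ∃ w, wordProd w = x ∧ w.length = inv x := by
  induction hn : inv x generalizing x with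
  | zero =>
    by_cases hx : x = 1
    · exact ⟨[], by simp [wordProd, hx], rfl⟩
    · obtain ⟨a, ha⟩ := exists_descent hx
      have := inv_mul_simple_of_descent ha
      omega
  | succ n ih =>
    have hx : x ≠ 1 := by rintro rfl; rw [inv_one] at hn; omega
    obtain ⟨a, ha⟩ := exists_descent hx
    have := inv_mul_simple_of_descent ha
    obtain ⟨w, hw, hl⟩ := ih (x * simple a) (by omega)
    exact ⟨w ++ [a], by rw [wordProd_append_singleton, hw, mul_simple_mul_simple], by simp [hl]⟩

/-- Each letter changes `inv` by one, and removing descents sorts x in exactly `inv x` steps, so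
minimal word length equals `inv`. -/
lemma isReducedExpr_iff {w : List (Letter d)} {x : Equiv.Perm (Fin d)} :
    IsReducedExpr w x ↔ wordProd w = x ∧ w.length = inv x := by
  constructor
  · rintro ⟨rfl, h⟩
    obtain ⟨v, hv, hl⟩ := exists_word (wordProd w)
    exact ⟨rfl, le_antisymm (hl ▸ h v hv) (inv_wordProd_le w)⟩
  · rintro ⟨rfl, h⟩
    exact ⟨rfl, fun v hv => by rw [h, ← hv]; exact inv_wordProd_le v⟩

/-- The strong exchange property. -/
lemma exchange (w : List (Letter d)) {i j : Fin d} (hij : i < j)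
    (h : wordProd w j < wordProd w i) :
    ∃ v : List (Letter d), v.Sublist w ∧ v.length + 1 = w.length ∧
      wordProd v = wordProd w * Equiv.swap i j ∧
      (∀ u a, w = u ++ [a] → v = u ∨ ∃ u', v = u' ++ [a] ∧ u'.length + 1 = u.length) := by
  induction w using List.reverseRecOn generalizing i j with
  | nil => simp only [wordProd, List.map_nil, List.prod_nil, Equiv.Perm.one_apply] at h; omega
  | append_singleton w a ih =>
    rw [wordProd_append_singleton] at h ⊢
    -- The pair (i, j) is carried leftwards through the letters until it is the pair exchanged by
    -- the current letter, which is then deleted. The last clause of the statement records whether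
    -- the final letter survives.
    by_cases hc : i.1 = a.1 ∧ j.1 = a.1 + 1
    · refine ⟨w, List.sublist_append_left _ _, by simp, ?_, ?_⟩
      · have : Equiv.swap i j = simple a := by
          unfold simple; congr 1 <;> exact Fin.ext (by simp [hc])
        rw [this, mul_simple_mul_simple]
      · intro u b e
        left
        exact (List.append_inj' e rfl).1
    · obtain ⟨v, hs, hl, hp, -⟩ := ih (simple_lt_simple a hij hc) h
      refine ⟨v ++ [a], hs.append (List.Sublist.refl _), by simp [hl], ?_, ?_⟩
      · rw [wordProd_append_singleton, hp]
        have : Equiv.swap (simple a i) (simple a j) * simple a = simple a * Equiv.swap i j := by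
          rw [Equiv.swap_apply_apply, inv_mul_cancel_right]
        rw [mul_assoc, this, mul_assoc]
      · intro u b e
        obtain ⟨rfl, e'⟩ := List.append_inj' e rfl
        obtain rfl := List.head_eq_of_cons_eq e'
        exact Or.inr ⟨v, rfl, hl⟩

/-- Deleting a letter multiplies on the right by a conjugate of a simple transposition, which is
again a transposition. -/
lemma exists_swap_of_delete {w v : List (Letter d)} (hs : v.Sublist w)
    (hl : w.length = v.length + 1) :
    ∃ i j : Fin d, i < j ∧ wordProd v = wordProd w * Equiv.swap i j := by
  induction w using List.reverseRecOn generalizing v with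
  | nil => simp at hl
  | append_singleton w a ih =>
    obtain ⟨v₁, v₂, rfl, h1, h2⟩ := List.sublist_append_iff.1 hs
    rw [wordProd_append_singleton]
    rcases List.sublist_singleton.1 h2 with rfl | rfl
    · have : v₁ = w := h1.eq_of_length (by simpa using hl.symm)
      subst this
      refine ⟨⟨a.1, Nat.lt_of_succ_lt a.2⟩, ⟨a.1 + 1, a.2⟩, by simp [Fin.lt_def], ?_⟩
      rw [List.append_nil]
      exact (mul_simple_mul_simple _ _).symm
    · obtain ⟨i, j, hij, e⟩ := ih h1 (by simpa using hl)
      have hne : simple a i ≠ simple a j := fun h => hij.ne ((simple a).injective h)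
      have e' : wordProd (v₁ ++ [a]) = wordProd w * simple a *
          Equiv.swap (simple a i) (simple a j) := by
        rw [wordProd_append_singleton, e, Equiv.swap_apply_apply]
        have : (simple a)⁻¹ = simple a := inv_eq_of_mul_eq_one_left (simple_mul_self a)
        rw [this, ← mul_assoc, ← mul_assoc, mul_simple_mul_simple]
      rcases lt_or_gt_of_ne hne with h | h
      · exact ⟨_, _, h, e'⟩
      · exact ⟨_, _, h, by rw [e', Equiv.swap_comm]⟩

/-- Otherwise (i, j) is an inversion of the product, and exchange would shorten a reduced word of
that product to a word of y. -/
lemma apply_lt_of_inv_lt {y : Equiv.Perm (Fin d)} {i j : Fin d} (hij : i < j)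
    (h : inv (y * Equiv.swap i j) < inv y) : y j < y i := by
  by_contra hc
  have hlt : y i < y j := lt_of_le_of_ne (not_lt.1 hc) fun e => hij.ne (y.injective e)
  obtain ⟨w, hw, hl⟩ := exists_word (y * Equiv.swap i j)
  obtain ⟨v, -, hl', hp, -⟩ := exchange w hij (by simpa [hw] using hlt)
  rw [hw, mul_assoc, Equiv.swap_mul_self, mul_one] at hp
  have := inv_wordProd_le v
  rw [hp] at this
  omega

/-- The reduced word w of y is arbitrary here; this freedom gives the transitivity used in
`LE.of_covered`. -/
lemma sublist_of_inv_eq {w : List (Letter d)} {y : Equiv.Perm (Fin d)} (hw : IsReducedExpr w y)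
    {i j : Fin d} (hij : i < j) (h : inv y = inv (y * Equiv.swap i j) + 1) :
    ∃ v, v.Sublist w ∧ IsReducedExpr v (y * Equiv.swap i j) := by
  obtain ⟨rfl, hl⟩ := isReducedExpr_iff.1 hw
  obtain ⟨v, hs, hl', hp, -⟩ := exchange w hij (apply_lt_of_inv_lt hij (by omega))
  exact ⟨v, hs, isReducedExpr_iff.2 ⟨hp, by omega⟩⟩

/-- A length difference of one means that a single letter is omitted; conversely, strong exchange
finds the letter to omit. -/
lemma covered_iff {x y : Equiv.Perm (Fin d)} :
    Covered x y ↔ inv y = inv x + 1 ∧ ∃ i j : Fin d, i < j ∧ x = y * Equiv.swap i j := by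
  constructor
  · rintro ⟨⟨⟨w, v, hw, hv, hs⟩, -⟩, hi⟩
    obtain ⟨rfl, hwl⟩ := isReducedExpr_iff.1 hw
    obtain ⟨rfl, hvl⟩ := isReducedExpr_iff.1 hv
    exact ⟨hi, exists_swap_of_delete hs (by omega)⟩
  · rintro ⟨hi, i, j, hij, rfl⟩
    obtain ⟨w, hw⟩ := exists_word y
    have hw := isReducedExpr_iff.2 hw
    obtain ⟨v, hs, hv⟩ := sublist_of_inv_eq hw hij hi
    exact ⟨⟨⟨w, v, hw, hv, hs⟩, fun e => by rw [e] at hi; omega⟩, hi⟩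

lemma Covered.inv_eq {x y : Equiv.Perm (Fin d)} (h : Covered x y) : inv y = inv x + 1 := h.2

lemma LE.of_covered {x y p : Equiv.Perm (Fin d)} (hxy : Covered x y) (h : LE y p) : LE x p := by
  obtain ⟨hi, i, j, hij, rfl⟩ := covered_iff.1 hxy
  obtain ⟨w, v, hw, hv, hs⟩ := h
  obtain ⟨u, hu, hr⟩ := sublist_of_inv_eq hv hij hi
  exact ⟨w, u, hw, hr, hu.trans hs⟩

lemma one_le (x : Equiv.Perm (Fin d)) : LE 1 x := by
  obtain ⟨w, hw⟩ := exists_word x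
  exact ⟨w, [], isReducedExpr_iff.2 hw, isReducedExpr_iff.2 ⟨by simp [wordProd], by simp [inv_one]⟩,
    List.nil_sublist _⟩

lemma le_refl (x : Equiv.Perm (Fin d)) : LE x x := by
  obtain ⟨w, hw⟩ := exists_word x
  have hw := isReducedExpr_iff.2 hw
  exact ⟨w, w, hw, hw, List.Sublist.refl _⟩

lemma covered_mul_simple {x : Equiv.Perm (Fin d)} {a : Letter d} (h : ¬ Descent x a) :
    Covered x (x * simple a) :=
  covered_iff.2 ⟨inv_mul_simple_of_not_descent h, ⟨a.1, Nat.lt_of_succ_lt a.2⟩, ⟨a.1 + 1, a.2⟩,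
    by simp [Fin.lt_def], (mul_simple_mul_simple x a).symm⟩

lemma mul_simple_covered {x : Equiv.Perm (Fin d)} {a : Letter d} (h : Descent x a) :
    Covered (x * simple a) x := by
  have := covered_mul_simple (x := x * simple a) (a := a)
    (fun h' => (descent_mul_simple x a).1 h' h)
  rwa [mul_simple_mul_simple] at this

/-- A cover from a non-descent to a descent is multiplication by the simple transposition. -/
lemma Covered.eq_mul_simple {x y : Equiv.Perm (Fin d)} (h : Covered x y) {a : Letter d}
    (hx : ¬ Descent x a) (hy : Descent y a) : x = y * simple a := by
  obtain ⟨hi, i, j, hij, rfl⟩ := covered_iff.1 h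
  obtain ⟨w, hw, hl⟩ := exists_word (y * simple a)
  have e : wordProd (w ++ [a]) = y := by
    rw [wordProd_append_singleton, hw, mul_simple_mul_simple]
  have hlt := apply_lt_of_inv_lt hij (show inv (y * Equiv.swap i j) < inv y by omega)
  obtain ⟨v, -, hlv, hp, hv⟩ := exchange (w ++ [a]) hij (by rwa [e])
  rw [e] at hp
  rw [← hp]
  rcases hv w a rfl with rfl | ⟨u, rfl, hu⟩
  · exact hw
  -- If the final letter survived, u would spell the product of the lower element with `simple a`.
  -- That product has length inv y, as a is a non-descent of the lower element, but u has only inv y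
  -- - 2 letters.
  · exfalso
    have h1 := inv_mul_simple_of_not_descent hx
    rw [← hp, wordProd_append_singleton, mul_simple_mul_simple, ← wordProd_append_singleton, hp]
      at h1
    have h2 := inv_wordProd_le u
    have h3 := inv_mul_simple_of_descent hy
    omega

/-- Conjugating by `simple a` keeps the quotient a transposition, and equal descent status shifts
both lengths the same way. -/
lemma Covered.mul_simple {x y : Equiv.Perm (Fin d)} (h : Covered x y) {a : Letter d}
    (hxy : Descent x a ↔ Descent y a) : Covered (x * simple a) (y * simple a) := by
  obtain ⟨hi, i, j, hij, e⟩ := covered_iff.1 h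
  have hne : simple a i ≠ simple a j := fun h => hij.ne ((simple a).injective h)
  have e' : x * simple a = y * simple a * Equiv.swap (simple a i) (simple a j) := by
    rw [e, Equiv.swap_apply_apply]
    have : (simple a)⁻¹ = simple a := inv_eq_of_mul_eq_one_left (simple_mul_self a)
    rw [this, ← mul_assoc, ← mul_assoc, mul_simple_mul_simple]
  refine covered_iff.2 ⟨?_, ?_⟩
  · by_cases hx : Descent x a
    · have := inv_mul_simple_of_descent hx
      have := inv_mul_simple_of_descent (hxy.1 hx)
      omega
    · have := inv_mul_simple_of_not_descent hx
      have := inv_mul_simple_of_not_descent (fun h => hx (hxy.2 h))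
      omega
  · rcases lt_or_gt_of_ne hne with h | h
    · exact ⟨_, _, h, e'⟩
    · exact ⟨_, _, h, by rw [e', Equiv.swap_comm]⟩

/-- The lifting property for chains of covers. -/
lemma lifting {x y : Equiv.Perm (Fin d)} {a : Letter d} (hy : Descent y a)
    (h : Relation.ReflTransGen Covered x y) :
    Relation.ReflTransGen Covered (x * simple a) y := by
  induction h using Relation.ReflTransGen.head_induction_on with
  | refl => exact .single (mul_simple_covered hy)
  | head hxz hzy ih =>
    rename_i x z
    by_cases hx : Descent x a
    · exact .head (mul_simple_covered hx) (.head hxz hzy)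
    · by_cases hz : Descent z a
      -- Here the first cover is x ◁ xs = z, so the rest of the chain already starts at xs.
      · rw [hxz.eq_mul_simple hx hz, mul_simple_mul_simple]
        exact hzy
      · exact .head (hxz.mul_simple (by simp [hx, hz])) ih

/-- Induction on the last letter a of w: a subword that omits it lies below the shorter prefix, and
one that uses it is reached by `lifting`, since a is a descent of the whole product. -/
lemma reflTransGen_of_sublist {w v : List (Letter d)} (hs : v.Sublist w)
    (hw : w.length = inv (wordProd w)) :
    Relation.ReflTransGen Covered (wordProd v) (wordProd w) := by
  induction w using List.reverseRecOn generalizing v with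
  | nil => rw [List.sublist_nil.1 hs]
  | append_singleton w a ih =>
    have hnd : ¬ Descent (wordProd w) a := fun h => by
      have h1 := inv_mul_simple_of_descent h
      have h2 := inv_wordProd_le w
      rw [wordProd_append_singleton, List.length_append, List.length_singleton] at hw
      omega
    have hw' : w.length = inv (wordProd w) := by
      have := inv_mul_simple_of_not_descent hnd
      rw [wordProd_append_singleton, List.length_append, List.length_singleton] at hw
      omega
    obtain ⟨v₁, v₂, rfl, h1, h2⟩ := List.sublist_append_iff.1 hs
    have hc : Relation.ReflTransGen Covered (wordProd v₁) (wordProd (w ++ [a])) := by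
      rw [wordProd_append_singleton]
      exact (ih h1 hw').tail (covered_mul_simple hnd)
    rcases List.sublist_singleton.1 h2 with rfl | rfl
    · rwa [List.append_nil]
    · rw [wordProd_append_singleton v₁]
      refine lifting ?_ hc
      rwa [wordProd_append_singleton, descent_mul_simple]

lemma le_iff_reflTransGen {x y : Equiv.Perm (Fin d)} :
    LE x y ↔ Relation.ReflTransGen Covered x y := by
  constructor
  · rintro ⟨w, v, hw, hv, hs⟩
    obtain ⟨rfl, hl⟩ := isReducedExpr_iff.1 hw
    rw [← hv.1]
    exact reflTransGen_of_sublist hs hl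
  · intro h
    induction h using Relation.ReflTransGen.head_induction_on with
    | refl => exact le_refl _
    | head hxz _ ih => exact ih.of_covered hxz

lemma mem_interval_iff {x y : Equiv.Perm (Fin d)} : x ∈ interval 1 y ↔ LE x y :=
  ⟨fun h => h.2, fun h => ⟨one_le x, h⟩⟩

lemma mem_interval_of_covered {x y p : Equiv.Perm (Fin d)} (h : Covered x y)
    (hy : y ∈ interval 1 p) : x ∈ interval 1 p :=
  ⟨one_le x, hy.2.of_covered h⟩

/-- This makes x ↦ xs an involution of [e, π], the matching behind the contracting homotopy. -/
lemma mul_simple_mem_interval {x p : Equiv.Perm (Fin d)} {a : Letter d} (hp : Descent p a)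
    (hx : x ∈ interval 1 p) : x * simple a ∈ interval 1 p := by
  rw [mem_interval_iff, le_iff_reflTransGen] at *
  exact lifting hp hx

/-- Bruhat intervals of length two have exactly two elements strictly inside. -/
lemma exists_middle_pair {z m y : Equiv.Perm (Fin d)} (hzm : Covered z m) (hmy : Covered m y) :
    ∃ b c, b ≠ c ∧ ∀ m', (Covered z m' ∧ Covered m' y) ↔ (m' = b ∨ m' = c) := by
  induction hn : inv y using Nat.strong_induction_on generalizing z m y with
  | _ n ih =>
  have hy1 : y ≠ 1 := by
    rintro rfl
    have := hmy.inv_eq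
    rw [inv_one] at this
    omega
  obtain ⟨a, hy⟩ := exists_descent hy1
  have hys : ¬ Descent (y * simple a) a := by rw [descent_mul_simple]; simpa using hy
  by_cases hz : Descent z a
  · have hzs : ¬ Descent (z * simple a) a := by rw [descent_mul_simple]; simpa using hz
    have : ∃ m', Covered (z * simple a) m' ∧ Covered m' (y * simple a) := by
      by_cases hm : Descent m a
      · exact ⟨m * simple a, hzm.mul_simple (by simp [hm, hz]), hmy.mul_simple (by simp [hm, hy])⟩
      · rw [← hmy.eq_mul_simple hm hy]
        exact ⟨z, mul_simple_covered hz, hzm⟩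
    obtain ⟨m', h1, h2⟩ := this
    obtain ⟨b, c, hbc, hm'⟩ := ih _ (by rw [← hn, inv_mul_simple_of_descent hy]; omega) h1 h2 rfl
    -- Middle elements r of [zs, ys] correspond to those of [z, y] by r ↦ rs, with one exception: r
    -- = z, the only possible one with descent a, would go to zs and is matched with ys instead.
    let f : Equiv.Perm (Fin d) → Equiv.Perm (Fin d) :=
      fun q => if q = z then y * simple a else q * simple a
    have hmid : ∀ q, (Covered (z * simple a) q ∧ Covered q (y * simple a)) →
        q = z ∨ ¬ Descent q a := by
      rintro q ⟨hq1, -⟩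
      by_cases hq : Descent q a
      · left
        have := hq1.eq_mul_simple hzs hq
        exact (mul_right_cancel this).symm
      · exact Or.inr hq
    have hb := hmid b ((hm' b).2 (Or.inl rfl))
    have hc := hmid c ((hm' c).2 (Or.inr rfl))
    have hzy : ∀ q, ¬ Descent q a → q * simple a ≠ y * simple a := by
      rintro q hq e
      rw [mul_right_cancel e] at hq
      exact hq hy
    refine ⟨f b, f c, ?_, fun q => ?_⟩
    · simp only [f]
      split_ifs with h1 h2 h2
      · exact absurd (h1.trans h2.symm) hbc
      · exact (hzy c (hc.resolve_left h2)).symm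
      · exact hzy b (hb.resolve_left h1)
      · exact fun e => hbc (mul_right_cancel e)
    · have hinv : ∀ q, (Covered z q ∧ Covered q y) ↔
          ∃ r, (Covered (z * simple a) r ∧ Covered r (y * simple a)) ∧ q = f r := by
        intro q
        constructor
        · rintro ⟨h1, h2⟩
          by_cases hq : Descent q a
          · refine ⟨q * simple a,
              ⟨h1.mul_simple (by simp [hq, hz]), h2.mul_simple (by simp [hq, hy])⟩, ?_⟩
            have : q * simple a ≠ z := by
              rintro rfl
              exact (descent_mul_simple q a).1 hz hq
            simp [f, this]
          · have e := h2.eq_mul_simple hq hy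
            exact ⟨z, ⟨mul_simple_covered hz, e ▸ h1⟩, by simp [f, e]⟩
        · rintro ⟨r, hr, rfl⟩
          by_cases h : r = z
          · subst h
            simp only [f, if_true]
            exact ⟨hr.2, mul_simple_covered hy⟩
          · have hrd := (hmid r hr).resolve_left h
            simp only [f, h, if_false]
            refine ⟨?_, ?_⟩
            · have := hr.1.mul_simple (a := a) (by simp [hrd, hzs])
              rwa [mul_simple_mul_simple] at this
            · have := hr.2.mul_simple (a := a) (by simp [hrd, hys])
              rwa [mul_simple_mul_simple] at this
      rw [hinv]
      simp only [hm']
      constructor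
      · rintro ⟨r, rfl | rfl, rfl⟩ <;> simp
      · rintro (rfl | rfl)
        · exact ⟨b, Or.inl rfl, rfl⟩
        · exact ⟨c, Or.inr rfl, rfl⟩
  · have hzs : Descent (z * simple a) a := (descent_mul_simple z a).2 hz
    -- With z a non-descent and y a descent, a middle element can only be ys or zs, according to its
    -- descent status. The given m is one of them, and multiplying its cover by s yields the other.
    have hboth : Covered z (y * simple a) ∧ Covered (z * simple a) y := by
      by_cases hm : Descent m a
      · have e := hzm.eq_mul_simple hz hm
        have h : Covered (z * simple a) y := by rw [e, mul_simple_mul_simple]; exact hmy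
        refine ⟨?_, h⟩
        have := h.mul_simple (a := a) (by simp [hzs, hy])
        rwa [mul_simple_mul_simple] at this
      · have h : Covered z (y * simple a) := by rw [← hmy.eq_mul_simple hm hy]; exact hzm
        refine ⟨h, ?_⟩
        have := h.mul_simple (a := a) (by simp [hz, hys])
        rwa [mul_simple_mul_simple] at this
    refine ⟨y * simple a, z * simple a, ?_, fun q => ⟨?_, ?_⟩⟩
    · intro e
      rw [mul_right_cancel e] at hy
      exact hz hy
    · rintro ⟨h1, h2⟩
      by_cases hq : Descent q a
      · right
        rw [h1.eq_mul_simple hz hq, mul_simple_mul_simple]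
      · exact Or.inl (h2.eq_mul_simple hq hy)
    · rintro (rfl | rfl)
      · exact ⟨hboth.1, mul_simple_covered hy⟩
      · exact ⟨covered_mul_simple hz, hboth.2⟩

end Combinatorics

end Bruhat

namespace Bruhat

/-! ### Existence and uniqueness of balanced signatures. -/

section Signatures

variable {d : ℕ}

/-- The two products of signs along the two sides of each square below `π` whose top has at
most `n` inversions are opposite. -/
def BalancedUpTo (n : ℕ) (f : Equiv.Perm (Fin d) → Equiv.Perm (Fin d) → ℤˣ) : Prop :=
  ∀ a b c z, inv a ≤ n → b ≠ c → Covered b a → Covered z b → Covered c a → Covered z c →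
    f b a * f z b * (f c a * f z c) = -1

/-- At a new top y with chosen descent s, the edge ys ◁ y gets sign 1, and each other edge x ◁ y the
sign forced by the square y, x, ys, xs. Working on the whole symmetric group avoids any choice
depending on π. -/
lemma exists_balancedUpTo (n : ℕ) :
    ∃ f : Equiv.Perm (Fin d) → Equiv.Perm (Fin d) → ℤˣ, BalancedUpTo n f := by
  classical
  induction n with
  | zero =>
    refine ⟨fun _ _ => 1, fun a b c z ha _ hba => ?_⟩
    have := hba.inv_eq
    omega
  | succ n ih =>
    obtain ⟨f, hf⟩ := ih
    have hch : ∀ y : Equiv.Perm (Fin d), inv y = n + 1 → ∃ a, Descent y a := fun y hy =>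
      exists_descent (by rintro rfl; rw [inv_one] at hy; omega)
    choose s hs using hch
    let g : Equiv.Perm (Fin d) → Equiv.Perm (Fin d) → ℤˣ := fun x y =>
      if h : inv y = n + 1 then
        if x = y * simple (s y h) then 1
        else -(f (x * simple (s y h)) x * f (x * simple (s y h)) (y * simple (s y h)))
      else f x y
    refine ⟨g, fun y b c z hy hbc hby hzb hcy hzc => ?_⟩
    have hb := hby.inv_eq
    have hc := hcy.inv_eq
    have hz := hzb.inv_eq
    have hgb : g z b = f z b := dif_neg (by omega)
    have hgc : g z c = f z c := dif_neg (by omega)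
    rw [hgb, hgc]
    by_cases hyn : inv y = n + 1
    swap
    · have hgb : g b y = f b y := dif_neg hyn
      have hgc : g c y = f c y := dif_neg hyn
      rw [hgb, hgc]
      exact hf y b c z (by omega) hbc hby hzb hcy hzc
    have hd := hs y hyn
    set a := s y hyn
    have hys : ¬ Descent (y * simple a) a := by rw [descent_mul_simple]; simpa using hd
    have hg1 : g (y * simple a) y = 1 := by simp only [g, dif_pos hyn]; exact if_pos rfl
    have hg2 : ∀ x, x ≠ y * simple a →
        g x y = -(f (x * simple a) x * f (x * simple a) (y * simple a)) := by
      intro x hx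
      simp only [g, dif_pos hyn]
      exact if_neg hx
    have hD : ∀ x, Covered x y → x ≠ y * simple a → Descent x a := fun x hx hne => by
      by_contra h
      exact hne (hx.eq_mul_simple h hd)
    have hsq : ∀ x, Covered x y → x ≠ y * simple a →
        Covered (x * simple a) (y * simple a) := fun x hx hne =>
      hx.mul_simple (by simp [hd, hD x hx hne])
    have hyi := (mul_simple_covered hd).inv_eq
    -- Squares with ys as one middle element. If w has descent a, the squares below x and below ys
    -- with bottom ws combine to give the sign; otherwise w = xs and the definition of g gives it
    -- directly.
    have main : ∀ x w, Covered x y → Covered w x → x ≠ y * simple a →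
        Covered w (y * simple a) →
        g x y * f w x * f w (y * simple a) = -1 := by
      intro x w hxy hwx hne hwy
      have hxd := hD x hxy hne
      have hx := hxy.inv_eq
      rw [hg2 x hne]
      by_cases hw : Descent w a
      · have e1 := hf x w (x * simple a) (w * simple a) (by omega)
          (by rintro e; exact (descent_mul_simple x a).1 (e ▸ hw) hxd) hwx (mul_simple_covered hw)
          (mul_simple_covered hxd) (hwx.mul_simple (by simp [hw, hxd]))
        have e2 := hf (y * simple a) w (x * simple a) (w * simple a) (by omega)
          (by rintro e; exact (descent_mul_simple x a).1 (e ▸ hw) hxd) hwy (mul_simple_covered hw)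
          (hsq x hxy hne) (hwx.mul_simple (by simp [hw, hxd]))
        generalize f (x * simple a) x = p1 at *
        generalize f (x * simple a) (y * simple a) = p2 at *
        generalize f w x = p3 at *
        generalize f w (y * simple a) = p4 at *
        generalize f (w * simple a) w = p5 at *
        generalize f (w * simple a) (x * simple a) = p6 at *
        clear * - e1 e2
        revert p1 p2 p3 p4 p5 p6
        decide
      · rw [hwx.eq_mul_simple hw hxd]
        generalize f (x * simple a) x = p1
        generalize f (x * simple a) (y * simple a) = p2
        revert p1 p2
        decide
    by_cases hb1 : b = y * simple a
    · rw [hb1, hg1]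
      have := main c z hcy hzc (fun e => hbc (hb1.trans e.symm)) (hb1 ▸ hzb)
      rw [← this, one_mul, mul_comm]
    by_cases hc1 : c = y * simple a
    · rw [hc1, hg1]
      have := main b z hby hzb hb1 (hc1 ▸ hzc)
      rw [← this, one_mul]
    -- Otherwise y, b, c, z and their products with s form a cube. Two faces are balanced by the
    -- definition of g and three by induction; each edge lies on two faces, so the sixth is balanced
    -- too.
    have hbd := hD b hby hb1
    have hcd := hD c hcy hc1
    have hzd : Descent z a := by
      by_contra h
      exact hbc (mul_right_cancel ((hzb.eq_mul_simple h hbd).symm.trans (hzc.eq_mul_simple h hcd)))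
    have hzs : ∀ x, Descent x a → z ≠ x * simple a := by
      rintro x hx e
      exact (descent_mul_simple x a).1 (e ▸ hzd) hx
    have e1 := hf b z (b * simple a) (z * simple a) (by omega) (hzs b hbd) hzb
      (mul_simple_covered hzd) (mul_simple_covered hbd) (hzb.mul_simple (by simp [hzd, hbd]))
    have e2 := hf c z (c * simple a) (z * simple a) (by omega) (hzs c hcd) hzc
      (mul_simple_covered hzd) (mul_simple_covered hcd) (hzc.mul_simple (by simp [hzd, hcd]))
    have e3 := hf (y * simple a) (b * simple a) (c * simple a) (z * simple a) (by omega)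
      (fun e => hbc (mul_right_cancel e)) (hsq b hby hb1) (hzb.mul_simple (by simp [hzd, hbd]))
      (hsq c hcy hc1) (hzc.mul_simple (by simp [hzd, hcd]))
    rw [hg2 b hb1, hg2 c hc1]
    generalize f (b * simple a) b = p1 at *
    generalize f (b * simple a) (y * simple a) = p2 at *
    generalize f (c * simple a) c = p3 at *
    generalize f (c * simple a) (y * simple a) = p4 at *
    generalize f z b = p5 at *
    generalize f z c = p6 at *
    generalize f (z * simple a) z = p7 at *
    generalize f (z * simple a) (b * simple a) = p8 at *
    generalize f (z * simple a) (c * simple a) = p9 at *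
    rcases Int.units_eq_one_or p7 with rfl | rfl <;>
    rcases Int.units_eq_one_or p8 with rfl | rfl <;>
    rcases Int.units_eq_one_or p9 with rfl | rfl <;>
    (clear * - e1 e2 e3; revert p1 p2 p3 p4 p5 p6; decide)

variable {π : Equiv.Perm (Fin d)}

open Classical in
/-- The sign of the edge `x ◁ y` in a balanced signature, extended by `1` to all pairs. -/
noncomputable def edgeSign (ε : BalancedSignature π) (x y : Equiv.Perm (Fin d)) : ℤˣ :=
  if h : (x ∈ interval 1 π ∧ y ∈ interval 1 π) ∧ Covered x y then
    ε.sign ⟨x, h.1.1⟩ ⟨y, h.1.2⟩ h.2 else 1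

lemma edgeSign_eq (ε : BalancedSignature π) (x y : interval 1 π) (h : Covered x.1 y.1) :
    ε.sign x y h = edgeSign ε x.1 y.1 := by
  unfold edgeSign
  rw [dif_pos ⟨⟨x.2, y.2⟩, h⟩]

lemma units_mul_eq_neg_one_iff (p q r t : ℤˣ) :
    ((p : ℤ) * q + r * t = 0) ↔ p * q * (r * t) = -1 := by
  revert p q r t
  decide

lemma edgeSign_balanced (ε : BalancedSignature π) {a b c z : Equiv.Perm (Fin d)}
    (ha : a ∈ interval 1 π) (hbc : b ≠ c) (hba : Covered b a) (hzb : Covered z b)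
    (hca : Covered c a) (hzc : Covered z c) :
    edgeSign ε b a * edgeSign ε z b * (edgeSign ε c a * edgeSign ε z c) = -1 := by
  have hb := mem_interval_of_covered hba ha
  have hc := mem_interval_of_covered hca ha
  have hz := mem_interval_of_covered hzb hb
  have := ε.balanced ⟨a, ha⟩ ⟨b, hb⟩ ⟨c, hc⟩ ⟨z, hz⟩ (by simpa using hbc) hba hzb hca hzc
  rw [units_mul_eq_neg_one_iff] at this
  simpa only [edgeSign_eq] using this

lemma exists_balancedSignature (π : Equiv.Perm (Fin d)) : Nonempty (BalancedSignature π) := by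
  classical
  obtain ⟨f, hf⟩ := exists_balancedUpTo (d := d) (Finset.univ.sup inv)
  refine ⟨⟨fun x y _ => f x y, fun a b c z hbc hba hzb hca hzc => ?_⟩⟩
  rw [units_mul_eq_neg_one_iff]
  exact hf a b c z (Finset.le_sup (Finset.mem_univ _)) (fun e => hbc (Subtype.ext e))
    hba hzb hca hzc

/-- Two balanced signatures differ by a coboundary. -/
lemma exists_coboundary (ε ε' : BalancedSignature π) :
    ∃ η : Equiv.Perm (Fin d) → ℤˣ, ∀ x y, y ∈ interval 1 π → Covered x y →
      edgeSign ε' x y * η x = η y * edgeSign ε x y := by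
  classical
  suffices h : ∀ n : ℕ, ∃ η : Equiv.Perm (Fin d) → ℤˣ, ∀ x y, inv y ≤ n → y ∈ interval 1 π →
      Covered x y → edgeSign ε' x y * η x = η y * edgeSign ε x y by
    obtain ⟨η, hη⟩ := h (Finset.univ.sup inv)
    exact ⟨η, fun x y => hη x y (Finset.le_sup (Finset.mem_univ _))⟩
  intro n
  induction n with
  | zero =>
    refine ⟨fun _ => 1, fun x y hy _ hxy => ?_⟩
    have := hxy.inv_eq
    omega
  | succ n ih =>
    obtain ⟨η, hη⟩ := ih
    have hch : ∀ y : Equiv.Perm (Fin d), inv y = n + 1 → ∃ a, Descent y a := fun y hy =>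
      exists_descent (by rintro rfl; rw [inv_one] at hy; omega)
    choose s hs using hch
    -- The edge ys ◁ y alone dictates η y.
    refine ⟨fun y => if h : inv y = n + 1 then
      η (y * simple (s y h)) * (edgeSign ε (y * simple (s y h)) y *
        edgeSign ε' (y * simple (s y h)) y) else η y, fun x y hyn hy hxy => ?_⟩
    have hx := hxy.inv_eq
    beta_reduce
    rw [dif_neg (show ¬ inv x = n + 1 by omega)]
    by_cases hyn' : inv y = n + 1
    swap
    · rw [dif_neg hyn']
      exact hη x y (by omega) hy hxy
    rw [dif_pos hyn']
    have hd := hs y hyn'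
    set a := s y hyn'
    have hys := mul_simple_covered hd
    have hysi := hys.inv_eq
    by_cases hne : x = y * simple a
    · subst hne
      generalize edgeSign ε (y * simple a) y = p1
      generalize edgeSign ε' (y * simple a) y = p2
      generalize η (y * simple a) = p3
      revert p1 p2 p3
      decide
    -- Compatibility on x ◁ y follows from that on the other three edges of the square y, x, ys, xs,
    -- which is balanced for both signatures.
    · have hxd : Descent x a := by
        by_contra h
        exact hne (hxy.eq_mul_simple h hd)
      have hxs := mul_simple_covered hxd
      have hsq := hxy.mul_simple (a := a) (by simp [hd, hxd])
      have e1 := edgeSign_balanced ε hy hne hxy hxs hys hsq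
      have e2 := edgeSign_balanced ε' hy hne hxy hxs hys hsq
      have e3 := hη _ x (by omega) (mem_interval_of_covered hxy hy) hxs
      have e4 := hη _ (y * simple a) (by omega) (mem_interval_of_covered hys hy) hsq
      generalize edgeSign ε x y = p1 at *
      generalize edgeSign ε' x y = q1 at *
      generalize edgeSign ε (x * simple a) x = p2 at *
      generalize edgeSign ε' (x * simple a) x = q2 at *
      generalize edgeSign ε (y * simple a) y = p3 at *
      generalize edgeSign ε' (y * simple a) y = q3 at *
      generalize edgeSign ε (x * simple a) (y * simple a) = p4 at *
      generalize edgeSign ε' (x * simple a) (y * simple a) = q4 at *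
      generalize η x = r1 at *
      generalize η (y * simple a) = r2 at *
      generalize η (x * simple a) = r3 at *
      have solve : ∀ u₁ u₂ u₃ u₄ : ℤˣ, u₁ * u₂ * (u₃ * u₄) = -1 → u₁ = -(u₂ * (u₃ * u₄)) := by
        decide
      have h1 : r1 = q2 * r3 * p2 := by rw [e3, mul_assoc, Int.units_mul_self, mul_one]
      have h2 : r2 = q4 * r3 * p4 := by rw [e4, mul_assoc, Int.units_mul_self, mul_one]
      rw [h1, h2, solve _ _ _ _ e1, solve _ _ _ _ e2]
      clear * -
      revert p2 p3 p4 q2 q3 q4 r3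
      decide

end Signatures

end Bruhat

namespace Bruhat

/-! ### The differential, its contracting homotopy and the cochain complexes. -/

section Complexes

variable (k : Type u) [CommRing k] {d : ℕ} {π : Equiv.Perm (Fin d)}

open Classical in
/-- The matrix of the differential of `(C[e, π], ∂_ε)`, with the permutations outside `[e, π]`
sent to zero. -/
noncomputable def diffMatrix (ε : BalancedSignature π) :
    Matrix (Equiv.Perm (Fin d)) (Equiv.Perm (Fin d)) k := fun y x =>
  if x ∈ interval 1 π ∧ Covered y x then ((edgeSign ε y x : ℤ) : k) else 0

open Classical in
/-- The matrix of a contracting homotopy of `(C[e, π], ∂_ε)` for a descent `a` of `π`. -/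
noncomputable def homotopyMatrix (ε : BalancedSignature π) (a : Letter d) :
    Matrix (Equiv.Perm (Fin d)) (Equiv.Perm (Fin d)) k := fun y x =>
  if y = x * simple a ∧ ¬ Descent x a then ((edgeSign ε x y : ℤ) : k) else 0

variable {k}

lemma diffMatrix_of_covered (ε : BalancedSignature π) {x y : Equiv.Perm (Fin d)}
    (hx : x ∈ interval 1 π) (h : Covered y x) :
    diffMatrix k ε y x = ((edgeSign ε y x : ℤ) : k) := if_pos ⟨hx, h⟩

lemma diffMatrix_of_not_covered (ε : BalancedSignature π) {x y : Equiv.Perm (Fin d)}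
    (h : ¬ Covered y x) : diffMatrix k ε y x = 0 := if_neg fun h' => h h'.2

lemma diffMatrix_of_notMem (ε : BalancedSignature π) {x y : Equiv.Perm (Fin d)}
    (h : x ∉ interval 1 π) : diffMatrix k ε y x = 0 := if_neg fun h' => h h'.1

/-- The entry at (z, a) sums over the middle elements between z and a: there are none, or exactly
two with opposite contributions. -/
lemma diffMatrix_mul_self (ε : BalancedSignature π) : diffMatrix k ε * diffMatrix k ε = 0 := by
  classical
  ext z a
  rw [Matrix.mul_apply, Matrix.zero_apply]
  by_cases ha : a ∈ interval 1 π
  swap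
  · exact Finset.sum_eq_zero fun b _ => by rw [diffMatrix_of_notMem ε ha, mul_zero]
  by_cases hm : ∃ m, Covered z m ∧ Covered m a
  swap
  · refine Finset.sum_eq_zero fun b _ => ?_
    by_cases h1 : Covered z b
    · rw [diffMatrix_of_not_covered ε (fun h2 => hm ⟨b, h1, h2⟩), mul_zero]
    · rw [diffMatrix_of_not_covered ε h1, zero_mul]
  obtain ⟨m, hzm, hma⟩ := hm
  obtain ⟨b, c, hbc, h⟩ := exists_middle_pair hzm hma
  obtain ⟨hzb, hba⟩ := (h b).2 (Or.inl rfl)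
  obtain ⟨hzc, hca⟩ := (h c).2 (Or.inr rfl)
  rw [← Finset.sum_subset (Finset.subset_univ {b, c}), Finset.sum_pair hbc,
    diffMatrix_of_covered ε ha hba, diffMatrix_of_covered ε ha hca,
    diffMatrix_of_covered ε (mem_interval_of_covered hba ha) hzb,
    diffMatrix_of_covered ε (mem_interval_of_covered hca ha) hzc]
  · have := (units_mul_eq_neg_one_iff _ _ _ _).2 (edgeSign_balanced ε ha hbc hba hzb hca hzc)
    rw [mul_comm ((_ : ℤ) : k), mul_comm (((edgeSign ε z c : ℤˣ) : ℤ) : k)]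
    exact_mod_cast congrArg (Int.cast : ℤ → k) this
  · intro q _ hq
    by_cases h1 : Covered z q
    · have h2 : ¬ Covered q a := fun h2 => hq (by simpa using (h q).1 ⟨h1, h2⟩)
      rw [diffMatrix_of_not_covered ε h2, mul_zero]
    · rw [diffMatrix_of_not_covered ε h1, zero_mul]

lemma cast_units_mul_self (u : ℤˣ) : ((u : ℤ) : k) * ((u : ℤ) : k) = 1 := by
  rw [← Int.cast_mul, ← Units.val_mul, Int.units_mul_self, Units.val_one, Int.cast_one]

lemma homotopyMatrix_mul_apply (ε : BalancedSignature π) (a : Letter d)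
    (N : Matrix (Equiv.Perm (Fin d)) (Equiv.Perm (Fin d)) k) (y x : Equiv.Perm (Fin d))
    (hy : Descent y a) :
    (homotopyMatrix k ε a * N) y x =
      ((edgeSign ε (y * simple a) y : ℤ) : k) * N (y * simple a) x := by
  rw [Matrix.mul_apply, Finset.sum_eq_single (y * simple a)]
  · congr 1
    refine if_pos ⟨by rw [mul_simple_mul_simple], ?_⟩
    rw [descent_mul_simple]
    simpa using hy
  · intro b _ hb
    rw [homotopyMatrix, if_neg, zero_mul]
    rintro ⟨rfl, -⟩
    exact hb (mul_simple_mul_simple _ _).symm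
  · simp

lemma homotopyMatrix_mul_apply_of_not_descent (ε : BalancedSignature π) (a : Letter d)
    (N : Matrix (Equiv.Perm (Fin d)) (Equiv.Perm (Fin d)) k) (y x : Equiv.Perm (Fin d))
    (hy : ¬ Descent y a) : (homotopyMatrix k ε a * N) y x = 0 := by
  rw [Matrix.mul_apply]
  refine Finset.sum_eq_zero fun b _ => ?_
  rw [homotopyMatrix, if_neg, zero_mul]
  rintro ⟨rfl, hb⟩
  exact hy ((descent_mul_simple b a).2 hb)

lemma mul_homotopyMatrix_apply (ε : BalancedSignature π) (a : Letter d)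
    (N : Matrix (Equiv.Perm (Fin d)) (Equiv.Perm (Fin d)) k) (y x : Equiv.Perm (Fin d))
    (hx : ¬ Descent x a) :
    (N * homotopyMatrix k ε a) y x =
      N y (x * simple a) * ((edgeSign ε x (x * simple a) : ℤ) : k) := by
  rw [Matrix.mul_apply, Finset.sum_eq_single (x * simple a)]
  · congr 1
    exact if_pos ⟨rfl, hx⟩
  · intro b _ hb
    rw [homotopyMatrix, if_neg (fun h => hb h.1), mul_zero]
  · simp

lemma mul_homotopyMatrix_apply_of_descent (ε : BalancedSignature π) (a : Letter d)
    (N : Matrix (Equiv.Perm (Fin d)) (Equiv.Perm (Fin d)) k) (y x : Equiv.Perm (Fin d))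
    (hx : Descent x a) : (N * homotopyMatrix k ε a) y x = 0 := by
  rw [Matrix.mul_apply]
  refine Finset.sum_eq_zero fun b _ => ?_
  rw [homotopyMatrix, if_neg (fun h => h.2 hx), mul_zero]

open Classical in
/-- The homotopy identity `∂ h + h ∂ = 1` on `[e, π]`. -/
lemma diffMatrix_homotopy (ε : BalancedSignature π) {a : Letter d} (hπ : Descent π a)
    {x : Equiv.Perm (Fin d)} (hx : x ∈ interval 1 π) (y : Equiv.Perm (Fin d)) :
    (diffMatrix k ε * homotopyMatrix k ε a + homotopyMatrix k ε a * diffMatrix k ε) y x =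
      if y = x then 1 else 0 := by
  rw [Matrix.add_apply]
  have hxs := mul_simple_mem_interval hπ hx
  by_cases hxd : Descent x a
  · rw [mul_homotopyMatrix_apply_of_descent ε a _ y x hxd, zero_add]
    by_cases hyd : Descent y a
    · rw [homotopyMatrix_mul_apply ε a _ y x hyd]
      split_ifs with hyx
      · subst hyx
        rw [diffMatrix_of_covered ε hx (mul_simple_covered hyd), cast_units_mul_self]
      · rw [diffMatrix_of_not_covered, mul_zero]
        intro h
        have hys : ¬ Descent (y * simple a) a := by rw [descent_mul_simple]; simpa using hyd
        exact hyx (mul_right_cancel (h.eq_mul_simple hys hxd))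
    · rw [homotopyMatrix_mul_apply_of_not_descent ε a _ y x hyd, if_neg]
      rintro rfl
      exact hyd hxd
  · have hxsd : Descent (x * simple a) a := (descent_mul_simple x a).2 hxd
    rw [mul_homotopyMatrix_apply ε a _ y x hxd]
    by_cases hyd : Descent y a
    · have hne : y ≠ x := by rintro rfl; exact hxd hyd
      rw [homotopyMatrix_mul_apply ε a _ y x hyd, if_neg hne]
      -- The ∂h term through xs and the h∂ term through ys are the two sides of the square xs, y, x,
      -- ys; they occur together or not at all.
      by_cases hc : Covered y (x * simple a)
      · have hc' : Covered (y * simple a) x := by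
          have := hc.mul_simple (a := a) (by simp [hyd, hxsd])
          rwa [mul_simple_mul_simple] at this
        rw [diffMatrix_of_covered ε hxs hc, diffMatrix_of_covered ε hx hc']
        have h := edgeSign_balanced ε hxs hne hc (mul_simple_covered hyd)
          (covered_mul_simple hxd) hc'
        generalize edgeSign ε y (x * simple a) = p1 at *
        generalize edgeSign ε x (x * simple a) = p2 at *
        generalize edgeSign ε (y * simple a) y = p3 at *
        generalize edgeSign ε (y * simple a) x = p4 at *
        -- Signs are their own inverses, so p1 p3 = -p2 p4 may be rearranged to p1 p2 = -p3 p4.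
        have h' : (p1 : ℤ) * p2 + p3 * p4 = 0 := by
          clear * - h
          revert p1 p2 p3 p4
          decide
        exact_mod_cast congrArg (Int.cast : ℤ → k) h'
      · rw [diffMatrix_of_not_covered ε hc, diffMatrix_of_not_covered, zero_mul, mul_zero,
          add_zero]
        intro h
        apply hc
        have := h.mul_simple (a := a) (by simp [descent_mul_simple, hyd, hxd])
        rwa [mul_simple_mul_simple] at this
    · rw [homotopyMatrix_mul_apply_of_not_descent ε a _ y x hyd, add_zero]
      split_ifs with hyx
      · subst hyx
        rw [diffMatrix_of_covered ε hxs (covered_mul_simple hxd), cast_units_mul_self]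
      · rw [diffMatrix_of_not_covered, zero_mul]
        intro h
        apply hyx
        have := h.eq_mul_simple hyd hxsd
        rwa [mul_simple_mul_simple] at this

/-! ### Cochains as functions on all permutations. -/

open Classical in
/-- Extension by zero of a cochain to all permutations. -/
noncomputable def extend {n : ℤ} (c : Degree π n →₀ k) (x : Equiv.Perm (Fin d)) : k :=
  if h : ∃ _ : x ∈ interval 1 π, -(inv x : ℤ) = n then c ⟨⟨x, h.1⟩, h.2⟩ else 0

lemma extend_apply {n : ℤ} (c : Degree π n →₀ k) (x : Degree π n) :
    extend c x.1.1 = c x := dif_pos ⟨x.1.2, x.2⟩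

lemma extend_of_not {n : ℤ} (c : Degree π n →₀ k) {x : Equiv.Perm (Fin d)}
    (h : ¬ ∃ _ : x ∈ interval 1 π, -(inv x : ℤ) = n) : extend c x = 0 := dif_neg h

lemma extend_injective {n : ℤ} : Function.Injective (extend (k := k) (π := π) (n := n)) := by
  intro c c' h
  ext x
  rw [← extend_apply, h, extend_apply]

lemma extend_zero {n : ℤ} : extend (0 : Degree π n →₀ k) = 0 := by
  ext x
  unfold extend
  split_ifs <;> rfl

lemma sum_extend {n : ℤ} [Fintype (Degree π n)] (c : Degree π n →₀ k) (g : Equiv.Perm (Fin d) → k) :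
    ∑ x, g x * extend c x = ∑ x : Degree π n, g x.1.1 * c x := by
  classical
  symm
  rw [← Finset.sum_subset (Finset.subset_univ
    (Finset.univ.image fun x : Degree π n => x.1.1)), Finset.sum_image]
  · exact Finset.sum_congr rfl fun x _ => by rw [extend_apply]
  · intro x _ y _ h
    exact Subtype.ext (Subtype.ext h)
  · intro x _ hx
    rw [extend_of_not, mul_zero]
    rintro ⟨h1, h2⟩
    exact hx (Finset.mem_image.2 ⟨⟨⟨x, h1⟩, h2⟩, Finset.mem_univ _, rfl⟩)

lemma extend_diff (ε : BalancedSignature π) {n : ℤ} (c : Degree π n →₀ k) :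
    extend (diff k ε n c) = (diffMatrix k ε).mulVec (extend c) := by
  classical
  ext y
  rw [Matrix.mulVec, dotProduct, sum_extend]
  by_cases hy : ∃ _ : y ∈ interval 1 π, -(inv y : ℤ) = n + 1
  · have e := extend_apply (diff k ε n c) ⟨⟨y, hy.1⟩, hy.2⟩
    dsimp only at e
    rw [e, diff, Finsupp.linearCombination_apply, Finsupp.sum_fintype _ _ (by simp),
      Finsupp.finsetSum_apply]
    refine Finset.sum_congr rfl fun x _ => ?_
    rw [Finsupp.smul_apply, Finsupp.finsetSum_apply, Finset.sum_eq_single ⟨⟨y, hy.1⟩, hy.2⟩,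
      smul_eq_mul, mul_comm]
    · congr 1
      split_ifs with h
      · rw [Finsupp.single_eq_same, diffMatrix_of_covered ε x.1.2 h, edgeSign_eq]
      · rw [diffMatrix_of_not_covered ε h, Finsupp.zero_apply]
    · intro z _ hz
      split_ifs with h
      · exact Finsupp.single_eq_of_ne (Ne.symm hz)
      · rfl
    · simp
  · rw [extend_of_not _ hy]
    refine (Finset.sum_eq_zero fun x _ => ?_).symm
    rw [diffMatrix_of_not_covered, zero_mul]
    intro h
    refine hy ⟨mem_interval_of_covered h x.1.2, ?_⟩
    have h1 := h.inv_eq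
    have h2 := x.2
    omega

lemma squareZero (ε : BalancedSignature π) : SquareZero k ε := by
  intro n
  ext1 x
  ext1
  apply extend_injective
  simp only [LinearMap.comp_apply, extend_diff, Matrix.mulVec_mulVec, diffMatrix_mul_self,
    Matrix.zero_mulVec, LinearMap.zero_apply, extend_zero]

/-- Every cocycle is a coboundary if `π` has a descent. -/
lemma exists_diff_eq (ε : BalancedSignature π) (hπ : π ≠ 1) {n : ℤ} (c : Degree π (n + 1) →₀ k)
    (hc : diff k ε (n + 1) c = 0) : ∃ b : Degree π n →₀ k, diff k ε n b = c := by
  classical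
  obtain ⟨a, ha⟩ := exists_descent hπ
  set v := (homotopyMatrix k ε a).mulVec (extend c) with hv
  have hsupp : ∀ x, extend c x ≠ 0 → ∃ _ : x ∈ interval 1 π, -(inv x : ℤ) = n + 1 :=
    fun x h => not_not.1 fun h' => h (extend_of_not c h')
  refine ⟨Finsupp.equivFunOnFinite.symm fun x => v x.1.1, extend_injective ?_⟩
  -- The homotopy raises `inv` by one and preserves [e, π], so v is supported in degree n and
  -- restricting it to that degree loses nothing.
  have hb : extend (Finsupp.equivFunOnFinite.symm fun x : Degree π n => v x.1.1) = v := by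
    ext x
    by_cases hx : ∃ _ : x ∈ interval 1 π, -(inv x : ℤ) = n
    · exact extend_apply (Finsupp.equivFunOnFinite.symm fun x : Degree π n => v x.1.1)
        ⟨⟨x, hx.1⟩, hx.2⟩
    · rw [extend_of_not _ hx, hv, Matrix.mulVec, dotProduct]
      refine (Finset.sum_eq_zero fun z _ => ?_).symm
      by_cases hz : extend c z = 0
      · rw [hz, mul_zero]
      · obtain ⟨h1, h2⟩ := hsupp z hz
        rw [homotopyMatrix, if_neg, zero_mul]
        rintro ⟨rfl, hd⟩
        refine hx ⟨mul_simple_mem_interval ha h1, ?_⟩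
        have := inv_mul_simple_of_not_descent hd
        omega
  have hzero : (diffMatrix k ε).mulVec (extend c) = 0 := by
    rw [← extend_diff, hc, extend_zero]
  have e : (diffMatrix k ε).mulVec v =
      (diffMatrix k ε * homotopyMatrix k ε a + homotopyMatrix k ε a * diffMatrix k ε).mulVec
        (extend c) := by
    rw [Matrix.add_mulVec, ← Matrix.mulVec_mulVec, ← Matrix.mulVec_mulVec, hzero,
      Matrix.mulVec_zero, add_zero]
  rw [extend_diff, hb, e]
  ext y
  -- The homotopy identity is available only for columns in [e, π]; elsewhere the extended cochain
  -- vanishes.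
  rw [Matrix.mulVec, dotProduct, Finset.sum_eq_single y]
  · by_cases hy : extend c y = 0
    · rw [hy, mul_zero]
    · rw [diffMatrix_homotopy ε ha (hsupp y hy).1, if_pos rfl, one_mul]
  · intro x _ hx
    by_cases hx' : extend c x = 0
    · rw [hx', mul_zero]
    · rw [diffMatrix_homotopy ε ha (hsupp x hx').1, if_neg hx.symm, zero_mul]
  · simp

lemma complex_d (ε : BalancedSignature π) (n : ℤ) :
    (complex k ε (squareZero ε)).d n (n + 1) = ModuleCat.ofHom (diff k ε n) :=
  CochainComplex.of_d (fun n => ModuleCat.of k (Degree π n →₀ k))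
    (fun n => ModuleCat.ofHom (diff k ε n)) n

lemma complex_acyclic (ε : BalancedSignature π) (hπ : π ≠ 1) :
    (complex k ε (squareZero ε)).Acyclic := by
  intro i
  obtain ⟨m, rfl⟩ : ∃ m, i = m + 1 := ⟨i - 1, by ring⟩
  rw [HomologicalComplex.exactAt_iff' _ m (m + 1) (m + 1 + 1) (by simp) (by simp),
    ShortComplex.moduleCat_exact_iff]
  intro c hc
  obtain ⟨b, hb⟩ := exists_diff_eq ε hπ (n := m) c (by
    change (complex k ε (squareZero ε)).d (m + 1) (m + 1 + 1) c = 0 at hc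
    rw [complex_d] at hc
    exact hc)
  refine ⟨b, ?_⟩
  change (complex k ε (squareZero ε)).d m (m + 1) b = c
  rw [complex_d]
  exact hb

/-- Rescaling of the basis by signs. -/
noncomputable def rescale (η : Equiv.Perm (Fin d) → ℤˣ) (n : ℤ) :
    (Degree π n →₀ k) →ₗ[k] (Degree π n →₀ k) :=
  Finsupp.linearCombination k fun x => Finsupp.single x ((η x.1.1 : ℤ) : k)

lemma rescale_apply (η : Equiv.Perm (Fin d) → ℤˣ) {n : ℤ} (c : Degree π n →₀ k)
    (x : Degree π n) : rescale η n c x = ((η x.1.1 : ℤ) : k) * c x := by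
  classical
  rw [rescale, Finsupp.linearCombination_apply, Finsupp.sum_fintype _ _ (by simp),
    Finsupp.finsetSum_apply, Finset.sum_eq_single x]
  · rw [Finsupp.smul_apply, Finsupp.single_eq_same, smul_eq_mul, mul_comm]
  · intro y _ hy
    rw [Finsupp.smul_apply, Finsupp.single_eq_of_ne hy.symm, smul_zero]
  · simp

lemma rescale_involutive (η : Equiv.Perm (Fin d) → ℤˣ) (n : ℤ) :
    Function.Involutive (rescale (k := k) (π := π) η n) := by
  intro c
  ext x
  rw [rescale_apply, rescale_apply, ← mul_assoc, cast_units_mul_self, one_mul]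

lemma extend_rescale (η : Equiv.Perm (Fin d) → ℤˣ) {n : ℤ} (c : Degree π n →₀ k)
    (x : Equiv.Perm (Fin d)) : extend (rescale η n c) x = ((η x : ℤ) : k) * extend c x := by
  unfold extend
  split_ifs
  · rw [rescale_apply]
  · rw [mul_zero]

lemma diff_rescale {ε ε' : BalancedSignature π} {η : Equiv.Perm (Fin d) → ℤˣ}
    (hη : ∀ x y, y ∈ interval 1 π → Covered x y →
      edgeSign ε' x y * η x = η y * edgeSign ε x y) {n : ℤ} (c : Degree π n →₀ k) :
    diff k ε' n (rescale η n c) = rescale η (n + 1) (diff k ε n c) := by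
  apply extend_injective
  ext y
  rw [extend_rescale, extend_diff, extend_diff, Matrix.mulVec, Matrix.mulVec, dotProduct,
    dotProduct, Finset.mul_sum]
  refine Finset.sum_congr rfl fun x _ => ?_
  rw [extend_rescale, ← mul_assoc, ← mul_assoc]
  congr 1
  by_cases hx : x ∈ interval 1 π
  swap
  · rw [diffMatrix_of_notMem _ hx, diffMatrix_of_notMem _ hx, zero_mul, mul_zero]
  by_cases hc : Covered y x
  · rw [diffMatrix_of_covered _ hx hc, diffMatrix_of_covered _ hx hc]
    have h : edgeSign ε' y x * η x = η y * edgeSign ε y x := by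
      -- The relation `hη` pairs ε' with η at the bottom of the edge, whereas commuting with the
      -- differentials needs η at the top; for signs the two are equivalent.
      have swap_units : ∀ p q r s : ℤˣ, p * r = s * q → p * s = r * q := by decide
      exact swap_units _ _ _ _ (hη y x hx hc)
    have := congrArg (fun u : ℤˣ => ((u : ℤ) : k)) h
    simpa only [Units.val_mul, Int.cast_mul] using this
  · rw [diffMatrix_of_not_covered _ hc, diffMatrix_of_not_covered _ hc, zero_mul, mul_zero]

lemma nonempty_complex_iso (ε ε' : BalancedSignature π) :
    Nonempty (complex k ε (squareZero ε) ≅ complex k ε' (squareZero ε')) := by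
  obtain ⟨η, hη⟩ := exists_coboundary ε ε'
  refine ⟨HomologicalComplex.Hom.isoOfComponents
    (fun n => (LinearEquiv.ofInvolutive (rescale (k := k) η n)
      (rescale_involutive η n)).toModuleIso) ?_⟩
  intro i j hij
  obtain rfl : i + 1 = j := hij
  rw [complex_d, complex_d]
  apply ModuleCat.hom_ext
  refine LinearMap.ext fun c => ?_
  exact diff_rescale hη c

end Complexes

end Bruhat

theorem mainTheorem5 (k : Type u) [CommRing k] (d : ℕ) (π : Equiv.Perm (Fin d)) (hπ : π ≠ 1) :
    ∃ hsq : ∀ ε : Bruhat.BalancedSignature π, Bruhat.SquareZero k ε,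
      (∃ ε : Bruhat.BalancedSignature π, (Bruhat.complex k ε (hsq ε)).Acyclic) ∧
      (∀ ε ε' : Bruhat.BalancedSignature π,
        Nonempty (Bruhat.complex k ε (hsq ε) ≅ Bruhat.complex k ε' (hsq ε'))) ∧
      (∀ ε : Bruhat.BalancedSignature π, (Bruhat.complex k ε (hsq ε)).Acyclic) := by
  refine ⟨fun ε => Bruhat.squareZero ε, ?_, fun ε ε' => Bruhat.nonempty_complex_iso ε ε',
    fun ε => Bruhat.complex_acyclic ε hπ⟩
  obtain ⟨ε⟩ := Bruhat.exists_balancedSignature π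
  exact ⟨ε, Bruhat.complex_acyclic ε hπ⟩
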